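/- Let $r:\mathbb R^m\to\mathbb R\cup\{+\infty\}$ be a lower semicontinuous convex function, let $\bar x\in\operatorname{dom} r=\{x: r(x)<\infty\}$, let $\bar u\in\partial r(\bar x)$ (the limiting subdifferential, which for convex $r$ is the subdifferential of convex analysis), and let $\sigma>0$. Let $r^*(x)=\sup_{u\in\operatorname{dom} r}\{\langle x,u\rangle-r(u)\}$ be the Fenchel conjugate of $r$, and for $\tau>0$ and a proper lower semicontinuous convex function $f$ let $$\operatorname{Prox}_{\tau f}(x)=\operatorname*{arg\,min}_{u\in\mathbb R^m}\Big\{f(u)+\tfrac1{2\tau}\|u-x\|^2\Big\}.$$ For a set $C\subset\mathbb R^N$ and $x\in C$, let $\widehat N_C(x)$ be the set of all $y$ with $\limsup_{x'\to x,\ x'\in C\setminus\{x\}}\langle y,x'-x\rangle/\|x'-x\|\le 0$, and let $N_C(x)$ be the set of all limits of sequences $y^k\in\widehat N_C(x^k)$ with $x^k\in C$, $x^k\to x$. The limiting coderivative of a single-valued mapping $S:\mathbb R^m\to\mathbb R^m$ at $x$ is given by $$v\in D^*S(x)(d)\iff (v,-d)\in N_{\operatorname{gph}S}(x,S(x)),$$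 and, for $S$ Lipschitz continuous, the Clarke generalized Jacobian $JS(x)$ is the convex hull of the set of all limits of Jacobian matrices $S'(x^k)$ along sequences $x^k\to x$ of points at which $S$ is differentiable. Then $\operatorname{Prox}_r$ and $\operatorname{Prox}_{\sigma r^*}$ are single-valued on all of $\mathbb R^m$, and for every $d\in\mathbb R^m$ and every $v\in D^*\operatorname{Prox}_{\sigma r^*}(\bar u+\sigma\bar x)(d)$ there is a matrix $U\in J\operatorname{Prox}_r(\bar x+\bar u)$ such that $I+(\sigma-1)U$ is invertible and $$v=(I+(\sigma-1)U)^{-1}(I-U)d.$$ -/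

import Mathlib

open Filter Topology

noncomputable section

namespace ProxCoderivative

/-! ### Extended-real-valued functions -/

section Functions

variable {E : Type*} [NormedAddCommGroup E] [InnerProductSpace ℝ E]

/-- The effective domain of an extended-real-valued function. -/
def effDom (r : E → EReal) : Set E := {x | r x < ⊤}

/-- The epigraph of an extended-real-valued function. -/
def epigraph (r : E → EReal) : Set (E × ℝ) := {p | r p.1 ≤ (p.2 : EReal)}

/-- The Fenchel conjugate `r*(x) = sup {⟨x, u⟩ - r(u) | u ∈ dom r}`. -/
def conjugate (r : E → EReal) (x : E) : EReal :=
  ⨆ u ∈ effDom r, (((inner ℝ x u : ℝ) : EReal) - r u)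

/-- The proximal mapping of `σ r` as a set-valued mapping:
`Prox_{σ r}(x) = argmin_u {r(u) + ‖u - x‖² / (2σ)}`. -/
def proxSet (σ : ℝ) (r : E → EReal) (x : E) : Set E :=
  {u | u ∈ effDom r ∧ ∀ w : E,
    r u + ((1 / (2 * σ) * ‖u - x‖ ^ 2 : ℝ) : EReal) ≤
      r w + ((1 / (2 * σ) * ‖w - x‖ ^ 2 : ℝ) : EReal)}

/-- The proximal mapping of `σ r` as a single-valued mapping: the element of `proxSet σ r x`
(there is exactly one when `r` is proper, lower semicontinuous and convex, and `0 < σ`). -/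
def prox (σ : ℝ) (r : E → EReal) (x : E) : E :=
  Classical.epsilon fun u => u ∈ proxSet σ r x

/-- The regular (Fréchet) subdifferential: those `y` with
`r(x') ≥ r(x) + ⟨y, x' - x⟩ + o(‖x' - x‖)`, for `x ∈ dom r`. -/
def regularSubdifferential (r : E → EReal) (x : E) : Set E :=
  {y | x ∈ effDom r ∧ ∀ ε : ℝ, 0 < ε → ∀ᶠ x' in 𝓝 x,
    r x + ((inner ℝ y (x' - x) - ε * ‖x' - x‖ : ℝ) : EReal) ≤ r x'}

/-- The limiting (Mordukhovich) subdifferential, for `x ∈ dom r`. -/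
def limitingSubdifferential (r : E → EReal) (x : E) : Set E :=
  {y | x ∈ effDom r ∧ ∃ (xs ys : ℕ → E),
    Tendsto xs atTop (𝓝 x) ∧ Tendsto (fun k => r (xs k)) atTop (𝓝 (r x)) ∧
    (∀ k, ys k ∈ regularSubdifferential r (xs k)) ∧ Tendsto ys atTop (𝓝 y)}

end Functions

/-! ### Normal cones and coderivatives -/

section Cones

variable {H : Type*} [NormedAddCommGroup H] [InnerProductSpace ℝ H]

/-- The regular (Fréchet) normal cone to `C` at `x ∈ C`: those `y` for which the upper limit of
`⟨y, x' - x⟩ / ‖x' - x‖`, as `x' → x` within `C \ {x}`, is at most `0`. -/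
def regularNormalCone (C : Set H) (x : H) : Set H :=
  {y | x ∈ C ∧ ∀ ε : ℝ, 0 < ε → ∀ᶠ x' in 𝓝[C] x, inner ℝ y (x' - x) ≤ ε * ‖x' - x‖}

/-- The limiting (Mordukhovich) normal cone to `C` at `x ∈ C`. -/
def limitingNormalCone (C : Set H) (x : H) : Set H :=
  {y | x ∈ C ∧ ∃ (xs ys : ℕ → H),
    (∀ k, xs k ∈ C) ∧ Tendsto xs atTop (𝓝 x) ∧
    (∀ k, ys k ∈ regularNormalCone C (xs k)) ∧ Tendsto ys atTop (𝓝 y)}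

end Cones

section Derivatives

variable {E F : Type*} [NormedAddCommGroup E] [InnerProductSpace ℝ E]
  [NormedAddCommGroup F] [InnerProductSpace ℝ F]

/-- The graph of a set-valued mapping, in the Euclidean product of the two spaces. -/
def gph (S : E → Set F) : Set (WithLp 2 (E × F)) := {p | p.snd ∈ S p.fst}

/-- The limiting coderivative `D*S(x, u)(w)` of a set-valued mapping `S` at `x` for `u ∈ S x`. -/
def limitingCoderivative (S : E → Set F) (x : E) (u : F) (w : F) : Set E :=
  {z | WithLp.toLp 2 (z, -w) ∈ limitingNormalCone (gph S) (WithLp.toLp 2 (x, u))}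

/-- The limiting Jacobian of `S` at `x`: all limits of derivatives of `S` at points of
differentiability that converge to `x`. -/
def limitingJacobian (S : E → F) (x : E) : Set (E →L[ℝ] F) :=
  {V | ∃ xs : ℕ → E, (∀ k, DifferentiableAt ℝ S (xs k)) ∧ Tendsto xs atTop (𝓝 x) ∧
    Tendsto (fun k => fderiv ℝ S (xs k)) atTop (𝓝 V)}

/-- The Clarke generalized Jacobian: the convex hull of the limiting Jacobian. -/
def clarkeJacobian (S : E → F) (x : E) : Set (E →L[ℝ] F) :=
  convexHull ℝ (limitingJacobian S x)

end Derivatives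

end ProxCoderivative

end

/-! Write `P` for `Prox_r`. A point `z` splits uniquely as `z = x + u` with `u ∈ ∂r(x)`, namely `x =
P z`. By Moreau's decomposition the graph of `Prox_{σ r*}` consists of the pairs `(u + σ x, u)`, so
it is the image of the Lipschitz map `Φ z = (z + (σ - 1) P z, z - P z)`. Pulling a normal `(v, -d)`
back along `Φ` turns it into a coderivative relation for the 1-Lipschitz map `P`, with `w = v - d`
and `e = -d - (σ - 1) v`. For Lipschitz maps such a relation gives `w = Uᵀ e` for some `U` in the
Clarke Jacobian (`exists_mem_clarkeJacobian_inner_eq`, by Hahn-Banach and a mean value inequality).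
Elements of the Clarke Jacobian of `P` are symmetric with `0 ≤ U ≤ I`
(`IsSubgradient.clarkeJacobian_resolvent`). Hence `v - d = U (-d - (σ - 1) v)`, which rearranges to
`(I + (σ - 1) U) v = (I - U) d`, and `I + (σ - 1) U` is positive definite. -/

noncomputable section
namespace ProxCoderivative
-- Subgradients and existence and uniqueness of proximal points.
section Convex
open scoped RealInnerProductSpace

variable {E : Type*} [NormedAddCommGroup E] [InnerProductSpace ℝ E]

/-- `u` is a subgradient of `f` at `x` in the sense of convex analysis. -/
def IsSubgradient (f : E → EReal) (x u : E) : Prop :=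
  ∃ a : ℝ, f x = a ∧ ∀ (z : E) (b : ℝ), f z = b → a + ⟪u, z - x⟫ ≤ b

theorem exists_eq_coe {X : Type*} {f : X → EReal} (hbot : ∀ x, f x ≠ ⊥) {x : X} (hx : f x < ⊤) :
    ∃ a : ℝ, f x = a :=
  ⟨(f x).toReal, (EReal.coe_toReal hx.ne (hbot x)).symm⟩

theorem apply_add_smul_sub_le {f : E → EReal} (hconv : Convex ℝ (epigraph f)) {x y : E} {a b t : ℝ}
    (hx : f x = a) (hy : f y = b) (ht : 0 ≤ t) (ht1 : t ≤ 1) :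
    f (x + t • (y - x)) ≤ ((a + t * (b - a) : ℝ) : EReal) := by
  have hx' : (x, a) ∈ epigraph f := hx.le
  have hy' : (y, b) ∈ epigraph f := hy.le
  have := hconv.add_smul_sub_mem hx' hy' ⟨ht, ht1⟩
  simpa [epigraph] using this

/-- Convexity bounds `f` above on the segment towards `z` by its chord. Dividing the local
inequality at `x + t • (z - x)` by `t` makes it global. -/
theorem IsSubgradient.of_mem_regularSubdifferential {f : E → EReal} (hbot : ∀ x, f x ≠ ⊥)
    (hconv : Convex ℝ (epigraph f)) {x u : E} (hu : u ∈ regularSubdifferential f x) :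
    IsSubgradient f x u := by
  obtain ⟨hx, hreg⟩ := hu
  obtain ⟨a, ha⟩ := exists_eq_coe hbot hx
  refine ⟨a, ha, fun z b hb => le_of_forall_pos_le_add fun ε hε => ?_⟩
  have hη : 0 < ε / (‖z - x‖ + 1) := by positivity
  have hline : Tendsto (fun t : ℝ => x + t • (z - x)) (𝓝[>] 0) (𝓝 x) := by
    have : Continuous fun t : ℝ => x + t • (z - x) := by fun_prop
    simpa using (this.tendsto 0).mono_left nhdsWithin_le_nhds
  obtain ⟨t, h1, ht⟩ := ((hline.eventually (hreg _ hη)).and (Ioc_mem_nhdsGT one_pos)).exists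
  have h2 := h1.trans (apply_add_smul_sub_le hconv ha hb ht.1.le ht.2)
  rw [ha, ← EReal.coe_add, EReal.coe_le_coe_iff, add_sub_cancel_left, inner_smul_right,
    norm_smul, Real.norm_of_nonneg ht.1.le] at h2
  have h5 : ε / (‖z - x‖ + 1) * (t * ‖z - x‖) ≤ t * ε := by
    have : ε / (‖z - x‖ + 1) * ‖z - x‖ ≤ ε := by
      rw [div_mul_eq_mul_div, div_le_iff₀ (by positivity)]
      nlinarith
    nlinarith [ht.1]
  have h6 : t * (a + ⟪u, z - x⟫) ≤ t * (b + ε) := by nlinarith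
  exact le_of_mul_le_mul_left h6 ht.1

theorem IsSubgradient.of_mem_limitingSubdifferential {f : E → EReal} (hbot : ∀ x, f x ≠ ⊥)
    (hconv : Convex ℝ (epigraph f)) {x u : E} (hu : u ∈ limitingSubdifferential f x) :
    IsSubgradient f x u := by
  obtain ⟨hx, xs, us, hxs, hfx, hus, hlim⟩ := hu
  obtain ⟨a, ha⟩ := exists_eq_coe hbot hx
  choose as has hsub using fun k => IsSubgradient.of_mem_regularSubdifferential hbot hconv (hus k)
  simp only [has, ha, EReal.tendsto_coe] at hfx
  exact ⟨a, ha, fun z b hb => le_of_tendsto (hfx.add (hlim.inner (tendsto_const_nhds.sub hxs)))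
    (Eventually.of_forall fun k => hsub k z b hb)⟩

theorem IsSubgradient.monotone {f : E → EReal} {x y u v : E} (hx : IsSubgradient f x u)
    (hy : IsSubgradient f y v) : 0 ≤ ⟪u - v, x - y⟫ := by
  obtain ⟨a, ha, h1⟩ := hx
  obtain ⟨b, hb, h2⟩ := hy
  have h3 := h1 y b hb
  have h4 := h2 x a ha
  rw [← neg_sub x y, inner_neg_right] at h3
  rw [inner_sub_left]
  linarith

theorem norm_sub_sq_eq_add (w p x : E) :
    ‖w - x‖ ^ 2 = ‖p - x‖ ^ 2 - 2 * ⟪x - p, w - p⟫ + ‖w - p‖ ^ 2 := by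
  have : w - x = (w - p) - (x - p) := by abel
  rw [this, norm_sub_sq_real, real_inner_comm, norm_sub_rev p x]
  ring

theorem mem_proxSet_of_isSubgradient {f : E → EReal} (hbot : ∀ x, f x ≠ ⊥) {σ : ℝ} (hσ : 0 < σ)
    {p u : E} (h : IsSubgradient f p u) : p ∈ proxSet σ f (p + σ • u) := by
  obtain ⟨a, ha, hsub⟩ := h
  have hp : p ∈ effDom f := by simp [effDom, ha]
  refine ⟨hp, fun w => ?_⟩
  by_cases hw : w ∈ effDom f
  · obtain ⟨b, hb⟩ := exists_eq_coe hbot hw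
    rw [ha, hb, ← EReal.coe_add, ← EReal.coe_add, EReal.coe_le_coe_iff]
    have h1 := hsub w b hb
    have h2 := norm_sub_sq_eq_add w p (p + σ • u)
    rw [add_sub_cancel_left, real_inner_smul_left] at h2
    have h3 : 1 / (2 * σ) * (2 * (σ * ⟪u, w - p⟫)) = ⟪u, w - p⟫ := by field_simp
    have h4 : 0 ≤ 1 / (2 * σ) * ‖w - p‖ ^ 2 := by positivity
    rw [h2, mul_add, mul_sub, h3]
    linarith
  · have hw' : f w = ⊤ := by simpa [effDom] using hw
    rw [hw', EReal.top_add_coe]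
    exact le_top

theorem IsSubgradient.of_mem_proxSet {f : E → EReal} (hbot : ∀ x, f x ≠ ⊥)
    (hconv : Convex ℝ (epigraph f)) {σ : ℝ} (hσ : 0 < σ) {x p : E} (h : p ∈ proxSet σ f x) :
    IsSubgradient f p (σ⁻¹ • (x - p)) := by
  obtain ⟨hp, hmin⟩ := h
  -- The quadratic remainder in the minimality inequality is `o(‖w - p‖)`, so a local subgradient
  -- suffices.
  refine .of_mem_regularSubdifferential hbot hconv ⟨hp, fun ε hε => ?_⟩
  obtain ⟨a, ha⟩ := exists_eq_coe hbot hp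
  have hnear : ∀ᶠ w in 𝓝 p, ‖w - p‖ < ε * (2 * σ) := by
    have : Continuous fun w => ‖w - p‖ := by fun_prop
    exact (this.tendsto p).eventually_lt_const (by simp; positivity)
  filter_upwards [hnear] with w hw
  by_cases hwd : w ∈ effDom f
  · obtain ⟨b, hb⟩ := exists_eq_coe hbot hwd
    have h1 := hmin w
    rw [ha, hb, ← EReal.coe_add, ← EReal.coe_add, EReal.coe_le_coe_iff,
      norm_sub_sq_eq_add w p x] at h1
    rw [ha, hb, ← EReal.coe_add, EReal.coe_le_coe_iff, real_inner_smul_left]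
    have h3 : 1 / (2 * σ) * (2 * ⟪x - p, w - p⟫) = σ⁻¹ * ⟪x - p, w - p⟫ := by field_simp
    have h4 : 1 / (2 * σ) * ‖w - p‖ ^ 2 ≤ ε * ‖w - p‖ := by
      rw [sq, ← mul_assoc]
      gcongr
      rw [one_div, inv_mul_le_iff₀ (by positivity)]
      linarith
    rw [mul_add, mul_sub, h3] at h1
    linarith
  · have hw' : f w = ⊤ := by simpa [effDom] using hwd
    rw [hw']
    exact le_top

theorem eq_of_mem_proxSet {f : E → EReal} (hbot : ∀ x, f x ≠ ⊥)
    (hconv : Convex ℝ (epigraph f)) {σ : ℝ} (hσ : 0 < σ) {x p q : E} (hp : p ∈ proxSet σ f x)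
    (hq : q ∈ proxSet σ f x) : p = q := by
  have h := (IsSubgradient.of_mem_proxSet hbot hconv hσ hp).monotone
    (IsSubgradient.of_mem_proxSet hbot hconv hσ hq)
  rw [← smul_sub, sub_sub_sub_cancel_left, ← neg_sub p q, smul_neg, inner_neg_left,
    real_inner_smul_left, real_inner_self_eq_norm_sq] at h
  have h1 : 0 ≤ σ⁻¹ * ‖p - q‖ ^ 2 := by positivity
  have h2 : σ⁻¹ * ‖p - q‖ ^ 2 = 0 := by linarith
  simpa [hσ.ne', sub_eq_zero] using h2

theorem proxSet_nonempty [FiniteDimensional ℝ E] {f : E → EReal} (hbot : ∀ x, f x ≠ ⊥)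
    (hlsc : LowerSemicontinuous f) {x₀ u₀ : E} (h₀ : IsSubgradient f x₀ u₀) {σ : ℝ} (hσ : 0 < σ)
    (x : E) : (proxSet σ f x).Nonempty := by
  obtain ⟨a, ha, hsub⟩ := h₀
  set q : E → ℝ := fun u => 1 / (2 * σ) * ‖u - x‖ ^ 2 with hq
  have hg : LowerSemicontinuous fun u => f u + ((q u : ℝ) : EReal) := by
    have hqc : Continuous fun u => ((q u : ℝ) : EReal) :=
      continuous_coe_real_ereal.comp (by fun_prop)
    exact hlsc.add' hqc.lowerSemicontinuous fun z =>
      EReal.continuousAt_add (.inr (EReal.coe_ne_bot _)) (.inr (EReal.coe_ne_top _))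
  -- Beyond distance `R` from `x₀` the quadratic term outweighs the affine minorant given by `u₀`,
  -- so the objective is at least its value at `x₀`.
  set R : ℝ := 2 * σ * ‖u₀ - σ⁻¹ • (x - x₀)‖ with hR
  have hR0 : 0 ≤ R := by positivity
  obtain ⟨p, -, hmin⟩ := (hg.lowerSemicontinuousOn (Metric.closedBall x₀ R)).exists_isMinOn
    ⟨x₀, Metric.mem_closedBall_self hR0⟩ (isCompact_closedBall x₀ R)
  have hpx₀ := hmin (Metric.mem_closedBall_self hR0)
  simp only [Set.mem_ofPred_eq] at hpx₀
  refine ⟨p, ?_, fun w => ?_⟩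
  · by_contra hp
    have hp' : f p = ⊤ := by simpa [effDom] using hp
    rw [hp', EReal.top_add_coe, ha, ← EReal.coe_add] at hpx₀
    exact EReal.coe_ne_top _ (top_le_iff.1 hpx₀)
  by_cases hwd : w ∈ effDom f
  · by_cases hw : w ∈ Metric.closedBall x₀ R
    · exact hmin hw
    · refine hpx₀.trans ?_
      obtain ⟨b, hb⟩ := exists_eq_coe hbot hwd
      rw [ha, hb, ← EReal.coe_add, ← EReal.coe_add, EReal.coe_le_coe_iff, hq]
      simp only
      rw [norm_sub_sq_eq_add w x₀ x]
      have h1 := hsub w b hb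
      rw [Metric.mem_closedBall, dist_eq_norm, not_le] at hw
      have h3 : 1 / (2 * σ) * (2 * ⟪x - x₀, w - x₀⟫) = ⟪σ⁻¹ • (x - x₀), w - x₀⟫ := by
        rw [real_inner_smul_left]; field_simp
      have h4 : -(‖u₀ - σ⁻¹ • (x - x₀)‖ * ‖w - x₀‖) ≤ ⟪u₀ - σ⁻¹ • (x - x₀), w - x₀⟫ :=
        neg_le_of_abs_le (abs_real_inner_le_norm _ _)
      have h5 : ‖u₀ - σ⁻¹ • (x - x₀)‖ * ‖w - x₀‖ ≤ 1 / (2 * σ) * ‖w - x₀‖ ^ 2 := by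
        rw [sq, ← mul_assoc]
        gcongr
        rw [one_div, le_inv_mul_iff₀ (by positivity)]
        exact hw.le
      rw [inner_sub_left] at h4
      rw [mul_add, mul_sub, h3]
      linarith
  · have hw' : f w = ⊤ := by simpa [effDom] using hwd
    rw [hw', EReal.top_add_coe]
    exact le_top

/-! ### Fenchel conjugates and Moreau's decomposition. -/

theorem conjugate_ne_bot {f : E → EReal} {x u : E} (h : IsSubgradient f x u) (y : E) :
    conjugate f y ≠ ⊥ := by
  obtain ⟨a, ha, -⟩ := h
  have hx : x ∈ effDom f := by simp [effDom, ha]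
  have h1 : ((⟪y, x⟫ : ℝ) : EReal) - f x ≤ conjugate f y :=
    le_iSup₂ (f := fun u (_ : u ∈ effDom f) => ((⟪y, u⟫ : ℝ) : EReal) - f u) x hx
  rw [ha, ← EReal.coe_sub] at h1
  exact ne_bot_of_le_ne_bot (EReal.coe_ne_bot _) h1

theorem IsSubgradient.conjugate {f : E → EReal} (hbot : ∀ x, f x ≠ ⊥) {x u : E}
    (h : IsSubgradient f x u) : IsSubgradient (conjugate f) u x := by
  obtain ⟨a, ha, hsub⟩ := h
  have hx : x ∈ effDom f := by simp [effDom, ha]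
  have hle : ∀ y, ((⟪y, x⟫ - a : ℝ) : EReal) ≤ ProxCoderivative.conjugate f y := fun y => by
    have := le_iSup₂ (f := fun u (_ : u ∈ effDom f) => ((⟪y, u⟫ : ℝ) : EReal) - f u) x hx
    rwa [ha, ← EReal.coe_sub] at this
  refine ⟨⟪u, x⟫ - a, le_antisymm (iSup₂_le fun z hz => ?_) (hle u), fun z b hb => ?_⟩
  · obtain ⟨b, hb⟩ := exists_eq_coe hbot hz
    rw [hb, ← EReal.coe_sub, EReal.coe_le_coe_iff]
    have := hsub z b hb
    rw [inner_sub_right] at this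
    linarith
  · have := hle z
    rw [hb, EReal.coe_le_coe_iff] at this
    rw [inner_sub_right, real_inner_comm z x, real_inner_comm u x]
    linarith

theorem convex_epigraph_conjugate {f : E → EReal} (hbot : ∀ x, f x ≠ ⊥) :
    Convex ℝ (epigraph (conjugate f)) := by
  -- The epigraph is an intersection of half-spaces.
  have hmem : ∀ p : E × ℝ, p ∈ epigraph (conjugate f) ↔
      ∀ u ∈ effDom f, ∀ a : ℝ, f u = a → ⟪p.1, u⟫ - a ≤ p.2 := by
    intro p
    simp only [epigraph, conjugate, Set.mem_ofPred_eq, iSup₂_le_iff]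
    refine forall₂_congr fun u hu => ?_
    obtain ⟨a, ha⟩ := exists_eq_coe hbot hu
    rw [ha, ← EReal.coe_sub, EReal.coe_le_coe_iff]
    exact ⟨fun h b hb => by rwa [← EReal.coe_injective hb], fun h => h a rfl⟩
  intro p hp q hq s t hs ht hst
  rw [hmem] at *
  intro u hu a ha
  have h1 := mul_le_mul_of_nonneg_left (hp u hu a ha) hs
  have h2 := mul_le_mul_of_nonneg_left (hq u hu a ha) ht
  simp only [Prod.fst_add, Prod.smul_fst, Prod.snd_add, Prod.smul_snd, smul_eq_mul,
    inner_add_left, real_inner_smul_left]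
  have h3 : a = s * a + t * a := by rw [← add_mul, hst, one_mul]
  linarith

/-- Moreau's decomposition: `Prox_{σ f*}` consists of the pairs `(u + σ x, u)` with `u ∈ ∂f(x)`. -/
theorem mem_proxSet_conjugate_iff [FiniteDimensional ℝ E] {f : E → EReal} (hbot : ∀ x, f x ≠ ⊥)
    (hlsc : LowerSemicontinuous f) (hconv : Convex ℝ (epigraph f)) {x₀ u₀ : E}
    (h₀ : IsSubgradient f x₀ u₀) {σ : ℝ} (hσ : 0 < σ) {y u : E} :
    u ∈ proxSet σ (conjugate f) y ↔ IsSubgradient f (σ⁻¹ • (y - u)) u := by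
  have hbot' := conjugate_ne_bot h₀
  have mpr : ∀ {x v}, IsSubgradient f x v → v ∈ proxSet σ (conjugate f) (v + σ • x) :=
    fun h => mem_proxSet_of_isSubgradient hbot' hσ (h.conjugate hbot)
  constructor
  · intro h
    -- A proximal point of `f` at `σ⁻¹ • y` splits `y` as `v + σ • x` with `v ∈ ∂f(x)`; uniqueness
    -- then gives `u = v`. Neither `f** = f` nor semicontinuity of `f*` is involved.
    obtain ⟨x, hx⟩ := proxSet_nonempty hbot hlsc h₀ (inv_pos.2 hσ) (σ⁻¹ • y)
    have hsub := IsSubgradient.of_mem_proxSet hbot hconv (inv_pos.2 hσ) hx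
    rw [inv_inv, smul_sub, smul_inv_smul₀ hσ.ne'] at hsub
    have h2 := mpr hsub
    rw [sub_add_cancel] at h2
    obtain rfl := eq_of_mem_proxSet hbot' (convex_epigraph_conjugate hbot) hσ h h2
    rwa [sub_sub_cancel, inv_smul_smul₀ hσ.ne']
  · intro h
    simpa [smul_inv_smul₀ hσ.ne'] using mpr h

theorem proxSet_conjugate_nonempty [FiniteDimensional ℝ E] {f : E → EReal} (hbot : ∀ x, f x ≠ ⊥)
    (hlsc : LowerSemicontinuous f) (hconv : Convex ℝ (epigraph f)) {x₀ u₀ : E}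
    (h₀ : IsSubgradient f x₀ u₀) {σ : ℝ} (hσ : 0 < σ) (y : E) :
    (proxSet σ (conjugate f) y).Nonempty := by
  obtain ⟨x, hx⟩ := proxSet_nonempty hbot hlsc h₀ (inv_pos.2 hσ) (σ⁻¹ • y)
  have hsub := IsSubgradient.of_mem_proxSet hbot hconv (inv_pos.2 hσ) hx
  rw [inv_inv, smul_sub, smul_inv_smul₀ hσ.ne'] at hsub
  refine ⟨y - σ • x, (mem_proxSet_conjugate_iff hbot hlsc hconv h₀ hσ).2 ?_⟩
  rwa [sub_sub_cancel, inv_smul_smul₀ hσ.ne']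

/-! ### The proximal mapping of a convex function -/

section Prox

variable {P : E → E} {f : E → EReal}

theorem IsSubgradient.norm_sq_resolvent_sub_le (hP : ∀ z, IsSubgradient f (P z) (z - P z))
    (z z' : E) : ‖P z - P z'‖ ^ 2 ≤ ⟪P z - P z', z - z'⟫ := by
  have h := (hP z).monotone (hP z')
  rw [sub_sub_sub_comm, inner_sub_left, real_inner_self_eq_norm_sq, real_inner_comm] at h
  linarith

theorem IsSubgradient.lipschitzWith_resolvent (hP : ∀ z, IsSubgradient f (P z) (z - P z)) :
    LipschitzWith 1 P := by
  refine LipschitzWith.of_dist_le_mul fun z z' => ?_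
  rw [dist_eq_norm, dist_eq_norm, NNReal.coe_one, one_mul]
  have h1 := (IsSubgradient.norm_sq_resolvent_sub_le hP z z').trans (real_inner_le_norm _ _)
  by_contra! hlt
  have h2 := norm_nonneg (z - z')
  nlinarith

/-- The resolvent is the gradient of the conjugate of the Moreau envelope, so that its derivatives
are symmetric. -/
theorem IsSubgradient.inner_fderiv_resolvent_comm (hP : ∀ z, IsSubgradient f (P z) (z - P z))
    {z : E} (hz : DifferentiableAt ℝ P z) (h k : E) :
    ⟪fderiv ℝ P z h, k⟫ = ⟪h, fderiv ℝ P z k⟫ := by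
  choose a ha hsub using hP
  -- The value of `sup_p ⟪x, p⟫ - ‖p‖² / 2 - f p`, attained at `P x`. `P` selects its subgradients
  -- and is Lipschitz, so the first-order error is quadratic and `∇g = P`; symmetry is that of the
  -- second derivative of `g`.
  set g : E → ℝ := fun x => ⟪x, P x⟫ - ‖P x‖ ^ 2 / 2 - a x with hg
  have hlow : ∀ x y, g x + ⟪P x, y - x⟫ ≤ g y := by
    intro x y
    have h1 := hsub y (P x) (a x) (ha x)
    have h2 : 0 ≤ ‖P x - P y‖ ^ 2 := sq_nonneg _
    rw [norm_sub_sq_real] at h2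
    simp only [hg, inner_sub_left, inner_sub_right, real_inner_self_eq_norm_sq] at h1 ⊢
    rw [real_inner_comm x (P x), real_inner_comm y (P x)]
    rw [real_inner_comm (P x) (P y)] at h1
    linarith
  have hlip : ∀ x y, ‖P y - P x‖ ≤ ‖y - x‖ := fun x y => by
    simpa using (IsSubgradient.lipschitzWith_resolvent
      (fun z => ⟨a z, ha z, hsub z⟩ : ∀ z, IsSubgradient f (P z) (z - P z))).norm_sub_le y x
  have hderiv : ∀ x, HasFDerivAt g (innerSL ℝ (P x)) x := by
    intro x
    suffices H : HasFDerivAt (fun y => g y - innerSL ℝ (P x) (y - x)) (0 : E →L[ℝ] ℝ) x by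
      have h1 : HasFDerivAt (fun y => innerSL ℝ (P x) (y - x)) (innerSL ℝ (P x)) x :=
        (innerSL ℝ (P x)).hasFDerivAt.comp x ((hasFDerivAt_id x).sub_const x)
      refine ((H.add h1).congr_fderiv (zero_add _)).congr_of_eventuallyEq ?_
      exact Eventually.of_forall fun y => by simp
    suffices H : HasFDerivAt (fun y => g y - innerSL ℝ (P x) (y - x) - g x) (0 : E →L[ℝ] ℝ) x by
      simpa using H.add_const (g x)
    refine Asymptotics.IsBigO.hasFDerivAt (n := 2) ?_ one_lt_two
    refine Asymptotics.IsBigO.of_bound 1 (Eventually.of_forall fun y => ?_)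
    have h1 := hlow x y
    have h2 := hlow y x
    rw [← neg_sub y x, inner_neg_right] at h2
    have h3 : ⟪P y - P x, y - x⟫ ≤ ‖y - x‖ ^ 2 :=
      (real_inner_le_norm _ _).trans (by rw [sq]; gcongr; exact hlip x y)
    rw [inner_sub_left] at h3
    rw [innerSL_apply_apply, Real.norm_of_nonneg (by linarith), Real.norm_of_nonneg (by positivity)]
    linarith
  have h2 : HasFDerivAt (fun x => innerSL ℝ (P x)) ((innerSL ℝ).comp (fderiv ℝ P z)) z :=
    (innerSL ℝ : E →L[ℝ] E →L[ℝ] ℝ).hasFDerivAt.comp z hz.hasFDerivAt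
  have := second_derivative_symmetric hderiv h2 h k
  simpa [real_inner_comm] using this

/-- Firm nonexpansiveness, divided by `s²`, passes to the limit of difference quotients. -/
theorem IsSubgradient.norm_sq_fderiv_resolvent_le (hP : ∀ z, IsSubgradient f (P z) (z - P z))
    {z : E} (hz : DifferentiableAt ℝ P z) (h : E) :
    ‖fderiv ℝ P z h‖ ^ 2 ≤ ⟪fderiv ℝ P z h, h⟫ := by
  have h1 : HasDerivAt (fun s : ℝ => P (z + s • h)) (fderiv ℝ P z h) 0 := by
    have h2 : HasDerivAt (fun s : ℝ => z + s • h) h 0 := by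
      simpa using ((hasDerivAt_id (0 : ℝ)).smul_const h).const_add z
    have h3 : HasFDerivAt P (fderiv ℝ P z) (z + (0 : ℝ) • h) := by simpa using hz.hasFDerivAt
    exact h3.comp_hasDerivAt 0 h2
  rw [hasDerivAt_iff_tendsto_slope] at h1
  refine le_of_tendsto_of_tendsto (h1.norm.pow 2) (h1.inner tendsto_const_nhds) ?_
  filter_upwards [self_mem_nhdsWithin] with s hs
  have hs' : s ≠ 0 := hs
  have h4 := IsSubgradient.norm_sq_resolvent_sub_le hP (z + s • h) z
  rw [add_sub_cancel_left, inner_smul_right] at h4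
  simp only [slope_def_module, sub_zero, zero_smul, add_zero, norm_smul, real_inner_smul_left,
    mul_pow, norm_inv, Real.norm_eq_abs, inv_pow, sq_abs]
  rw [inv_mul_le_iff₀ (by positivity)]
  refine h4.trans (le_of_eq ?_)
  field_simp

theorem IsSubgradient.clarkeJacobian_resolvent (hP : ∀ z, IsSubgradient f (P z) (z - P z))
    {z : E} {U : E →L[ℝ] E} (hU : U ∈ clarkeJacobian P z) :
    (∀ h k, ⟪U h, k⟫ = ⟪h, U k⟫) ∧ ∀ h, 0 ≤ ⟪U h, h⟫ ∧ ⟪U h, h⟫ ≤ ‖h‖ ^ 2 := by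
  -- These conditions are stable under limits and convex combinations, so they need checking only on
  -- derivatives of `P`.
  let C : Set (E →L[ℝ] E) :=
    {U | (∀ h k, ⟪U h, k⟫ = ⟪h, U k⟫) ∧ ∀ h, 0 ≤ ⟪U h, h⟫ ∧ ⟪U h, h⟫ ≤ ‖h‖ ^ 2}
  have hC : Convex ℝ C := by
    rintro U ⟨hU1, hU2⟩ V ⟨hV1, hV2⟩ s t hs ht hst
    refine ⟨fun h k => ?_, fun h => ?_⟩
    · simp [inner_add_left, inner_add_right, real_inner_smul_left, inner_smul_right, hU1, hV1]
    · obtain ⟨h1, h2⟩ := hU2 h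
      obtain ⟨h3, h4⟩ := hV2 h
      simp only [add_apply, smul_apply, inner_add_left,
        real_inner_smul_left]
      refine ⟨by positivity, ?_⟩
      calc _ ≤ s * ‖h‖ ^ 2 + t * ‖h‖ ^ 2 := by gcongr
        _ = _ := by rw [← add_mul, hst, one_mul]
  refine convexHull_min (t := C) ?_ hC hU
  rintro V ⟨xs, hd, -, hV⟩
  have hlim : ∀ h, Tendsto (fun k => fderiv ℝ P (xs k) h) atTop (𝓝 (V h)) := fun h =>
    ((ContinuousLinearMap.apply ℝ E h).continuous.tendsto V).comp hV
  refine ⟨fun h k => ?_, fun h => ⟨?_, ?_⟩⟩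
  · refine tendsto_nhds_unique ((hlim h).inner tendsto_const_nhds)
      ((tendsto_const_nhds.inner (hlim k)).congr fun n => ?_)
    exact (IsSubgradient.inner_fderiv_resolvent_comm hP (hd n) h k).symm
  · exact ge_of_tendsto ((hlim h).inner tendsto_const_nhds) (Eventually.of_forall fun n =>
      (sq_nonneg _).trans (IsSubgradient.norm_sq_fderiv_resolvent_le hP (hd n) h))
  · refine le_of_tendsto ((hlim h).inner tendsto_const_nhds) (Eventually.of_forall fun n => ?_)
    have h1 := IsSubgradient.norm_sq_fderiv_resolvent_le hP (hd n) h
    have h2 := real_inner_le_norm (fderiv ℝ P (xs n) h) h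
    nlinarith [sq_nonneg (‖fderiv ℝ P (xs n) h‖ - ‖h‖), sq_nonneg ‖fderiv ℝ P (xs n) h‖]

end Prox
end Convex

/-! ### Clarke Jacobians and graph normals of Lipschitz maps. -/

section Clarke
open MeasureTheory Set Metric
open scoped NNReal RealInnerProductSpace

/-- By Carathéodory, `dim V + 1` points suffice, so the hull is a continuous image of a simplex
times a power of `K`. Shorter combinations are padded with zero weights. -/
theorem isCompact_convexHull_of_finiteDimensional {V : Type*} [NormedAddCommGroup V]
    [NormedSpace ℝ V] [FiniteDimensional ℝ V] {K : Set V} (hK : IsCompact K) :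
    IsCompact (convexHull ℝ K) := by
  let n := Module.finrank ℝ V + 1
  let Φ : (Fin n → ℝ) × (Fin n → V) → V := fun p => ∑ i, p.1 i • p.2 i
  have hΦ : Continuous Φ := by
    refine continuous_finsetSum _ fun i _ => ?_
    fun_prop
  have hc : IsCompact (stdSimplex ℝ (Fin n) ×ˢ Set.univ.pi fun _ : Fin n => K) :=
    (isCompact_stdSimplex ℝ (Fin n)).prod (isCompact_univ_pi fun _ => hK)
  convert hc.image hΦ
  apply Subset.antisymm
  · intro x hx
    obtain ⟨x₀, hx₀⟩ : K.Nonempty := convexHull_nonempty_iff.1 ⟨x, hx⟩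
    obtain ⟨ι, _, z, w, hz, hind, hw, hw1, rfl⟩ := eq_pos_convex_span_of_mem_convexHull hx
    have hcard : Fintype.card ι ≤ n :=
      hind.card_le_finrank_succ.trans (Nat.succ_le_succ (Submodule.finrank_le _))
    obtain ⟨f⟩ : Nonempty (ι ↪ Fin n) :=
      Function.Embedding.nonempty_of_card_le (by simpa using hcard)
    have hext : ∀ i, Function.extend f w 0 (f i) = w i := f.injective.extend_apply _ _
    have hext' : ∀ j ∉ range f, Function.extend f w 0 j = 0 := fun j hj =>
      Function.extend_apply' _ _ _ hj
    refine ⟨(Function.extend f w 0, Function.extend f z fun _ => x₀), ⟨⟨fun j => ?_, ?_⟩,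
      fun j _ => ?_⟩, ?_⟩
    · by_cases hj : j ∈ range f
      · obtain ⟨i, rfl⟩ := hj
        simpa only [hext] using (hw i).le
      · simp only [hext' j hj, le_refl]
    · rw [← hw1]
      exact (Fintype.sum_of_injective f f.injective _ _ hext' fun i => (hext i).symm).symm
    · by_cases hj : j ∈ range f
      · obtain ⟨i, rfl⟩ := hj
        simp only [f.injective.extend_apply]
        exact hz ⟨i, rfl⟩
      · simpa only [Function.extend_apply' _ _ _ hj] using hx₀
    · refine (Fintype.sum_of_injective f f.injective _ _ (fun j hj => ?_) fun i => ?_).symm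
      · simp only [hext' j hj, zero_smul]
      · simp only [f.injective.extend_apply]
  · rintro _ ⟨⟨w, z⟩, ⟨hw, hz⟩, rfl⟩
    exact (convex_convexHull ℝ K).sum_mem (fun i _ => hw.1 i) hw.2
      fun i _ => subset_convexHull ℝ K (hz i (mem_univ i))

variable {E F : Type*} [NormedAddCommGroup E] [InnerProductSpace ℝ E]
  [NormedAddCommGroup F] [InnerProductSpace ℝ F]

theorem isClosed_limitingJacobian (S : E → F) (x : E) : IsClosed (limitingJacobian S x) := by
  have : limitingJacobian S x = (fun V => (x, V)) ⁻¹'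
      closure ((fun y => (y, fderiv ℝ S y)) '' {y | DifferentiableAt ℝ S y}) := by
    ext V
    simp only [limitingJacobian, mem_ofPred_eq, mem_preimage, mem_closure_iff_seq_limit]
    constructor
    · rintro ⟨xs, h1, h2, h3⟩
      exact ⟨fun k => (xs k, fderiv ℝ S (xs k)), fun k => ⟨xs k, h1 k, rfl⟩, h2.prodMk_nhds h3⟩
    · rintro ⟨ps, h1, h2⟩
      choose xs hxs hps using h1
      obtain rfl : (fun k => (xs k, fderiv ℝ S (xs k))) = ps := funext hps
      exact ⟨xs, hxs, (continuous_fst.tendsto _).comp h2, (continuous_snd.tendsto _).comp h2⟩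
  rw [this]
  exact isClosed_closure.preimage (by fun_prop)

theorem norm_le_of_mem_limitingJacobian {S : E → F} {K : ℝ≥0} (hS : LipschitzWith K S) {x : E}
    {V : E →L[ℝ] F} (hV : V ∈ limitingJacobian S x) : ‖V‖ ≤ K := by
  obtain ⟨xs, -, -, h⟩ := hV
  exact le_of_tendsto h.norm (Eventually.of_forall fun k => norm_fderiv_le_of_lipschitz ℝ hS)

/-- The scalar function along the segment is Lipschitz, hence absolutely continuous, hence the
integral of its derivative. -/
theorem inner_add_smul_sub_le_of_ae {S : E → F} {K : ℝ≥0} (hS : LipschitzWith K S) {y h : E}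
    {e : F} {c t : ℝ} (ht : 0 ≤ t) (hd : ∀ᵐ s : ℝ, DifferentiableAt ℝ S (y + s • h))
    (hc : ∀ s ∈ Icc 0 t, DifferentiableAt ℝ S (y + s • h) →
      ⟪e, fderiv ℝ S (y + s • h) h⟫ ≤ c) :
    ⟪e, S (y + t • h) - S y⟫ ≤ c * t := by
  set φ : ℝ → ℝ := fun s => ⟪e, S (y + s • h)⟫ with hφ
  have hlip : LipschitzWith (‖e‖₊ * (K * ‖h‖₊)) φ := by
    refine LipschitzWith.of_dist_le_mul fun s s' => ?_
    have h1 : ‖S (y + s • h) - S (y + s' • h)‖ ≤ K * (‖h‖ * ‖s - s'‖) := by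
      refine (hS.norm_sub_le _ _).trans ?_
      rw [add_sub_add_left_eq_sub, ← sub_smul, norm_smul, mul_comm ‖h‖]
    rw [Real.dist_eq, hφ]
    simp only
    rw [← inner_sub_right]
    refine (abs_real_inner_le_norm _ _).trans ?_
    calc _ ≤ ‖e‖ * (K * (‖h‖ * ‖s - s'‖)) := by gcongr
      _ = _ := by simp [Real.dist_eq]; ring
  have hac := (hlip.lipschitzOnWith (s := uIcc 0 t)).absolutelyContinuousOnInterval
  have hint := hac.integral_deriv_eq_sub
  have hle : ∫ s in (0 : ℝ)..t, deriv φ s ≤ ∫ _ in (0 : ℝ)..t, c := by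
    refine intervalIntegral.integral_mono_ae_restrict ht hac.intervalIntegrable_deriv
      intervalIntegrable_const ?_
    filter_upwards [ae_restrict_of_ae hd, ae_restrict_mem measurableSet_Icc] with s hs hst
    have h2 : HasDerivAt (fun s : ℝ => y + s • h) h s := by
      simpa using ((hasDerivAt_id s).smul_const h).const_add y
    have h3 : HasDerivAt (fun s => S (y + s • h)) (fderiv ℝ S (y + s • h) h) s :=
      hs.hasFDerivAt.comp_hasDerivAt s h2
    have h4 : HasDerivAt φ ⟪e, fderiv ℝ S (y + s • h) h⟫ s := by
      simpa using (hasDerivAt_const s e).inner ℝ h3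
    rw [h4.deriv]
    exact hc s hst hs
  rw [hint] at hle
  simp only [hφ, zero_smul, add_zero, intervalIntegral.integral_const, sub_zero,
    smul_eq_mul] at hle
  rw [inner_sub_right]
  linarith

variable [FiniteDimensional ℝ E] [FiniteDimensional ℝ F]

theorem isCompact_clarkeJacobian {S : E → F} {K : ℝ≥0} (hS : LipschitzWith K S) (x : E) :
    IsCompact (clarkeJacobian S x) := by
  apply isCompact_convexHull_of_finiteDimensional
  refine Metric.isCompact_of_isClosed_isBounded (isClosed_limitingJacobian S x) ?_
  exact isBounded_closedBall.subset fun V hV =>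
    mem_closedBall_zero_iff.2 (norm_le_of_mem_limitingJacobian hS hV)

/-- Otherwise, derivatives violating the bound at points tending to `x`, being bounded by `K`, would
accumulate at an element of the limiting Jacobian. -/
theorem exists_ball_inner_fderiv_le {S : E → F} {K : ℝ≥0} (hS : LipschitzWith K S) {x h : E}
    {e : F} {c : ℝ} (hc : ∀ U ∈ limitingJacobian S x, ⟪e, U h⟫ < c) :
    ∃ δ > 0, ∀ z ∈ ball x δ, DifferentiableAt ℝ S z → ⟪e, fderiv ℝ S z h⟫ ≤ c := by
  by_contra! hcon
  choose! zs hzs hd hgt using fun k : ℕ => hcon (1 / ((k : ℝ) + 1)) Nat.one_div_pos_of_nat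
  have hzx : Tendsto zs atTop (𝓝 x) := by
    rw [tendsto_iff_dist_tendsto_zero]
    exact squeeze_zero (fun _ => dist_nonneg) (fun k => (hzs k).le)
      tendsto_one_div_add_atTop_nhds_zero_nat
  obtain ⟨V, -, φ, hφ, hV⟩ := (isCompact_closedBall (0 : E →L[ℝ] F) K).tendsto_subseq
    (x := fun k => fderiv ℝ S (zs k))
    fun k => mem_closedBall_zero_iff.2 (norm_fderiv_le_of_lipschitz ℝ hS)
  have hVJ : V ∈ limitingJacobian S x :=
    ⟨zs ∘ φ, fun k => hd _, hzx.comp hφ.tendsto_atTop, hV⟩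
  have hcont : Continuous fun U : E →L[ℝ] F => ⟪e, U h⟫ := by fun_prop
  have : c ≤ ⟪e, V h⟫ := ge_of_tendsto ((hcont.tendsto V).comp hV)
    (Eventually.of_forall fun k => (hgt (φ k)).le)
  exact absurd (hc V hVJ) this.not_gt

variable [MeasurableSpace E] [BorelSpace E]

/-- Fubini and translation invariance: almost every line in direction `h` meets a null set in a null
set. -/
theorem ae_ae_add_smul {p : E → Prop} (μ : Measure E) [μ.IsAddHaarMeasure]
    (hp : ∀ᵐ y ∂μ, p y) (h : E) : ∀ᵐ y ∂μ, ∀ᵐ s : ℝ, p (y + s • h) := by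
  obtain ⟨N, hN, mN, hN0⟩ := exists_measurable_superset_of_null hp
  suffices H : ∀ᵐ q ∂(μ.prod (volume : Measure ℝ)), q.1 + q.2 • h ∈ Nᶜ by
    filter_upwards [Measure.ae_ae_of_ae_prod H] with y hy
    filter_upwards [hy] with s hs
    by_contra hc
    exact hs (hN hc)
  have hm : MeasurableSet {q : E × ℝ | q.1 + q.2 • h ∈ Nᶜ} := by
    have : Measurable fun q : E × ℝ => q.1 + q.2 • h := by fun_prop
    exact this mN.compl
  have hm' : MeasurableSet {q : ℝ × E | q.2 + q.1 • h ∈ Nᶜ} := by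
    have : Measurable fun q : ℝ × E => q.2 + q.1 • h := by fun_prop
    exact this mN.compl
  have H : ∀ᵐ q ∂((volume : Measure ℝ).prod μ), q.2 + q.1 • h ∈ Nᶜ := by
    rw [Measure.ae_prod_iff_ae_ae hm']
    refine Eventually.of_forall fun s => ?_
    have : μ ((fun y => y + s • h) ⁻¹' N) = 0 := by rw [measure_preimage_add_right, hN0]
    rw [ae_iff]
    simp only [mem_compl_iff, not_not]
    exact this
  exact Measure.measurePreserving_swap.quasiMeasurePreserving.ae H

/-- A mean value inequality for Lipschitz mappings, from a bound on the derivatives at the points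
of differentiability. -/
theorem inner_add_smul_sub_le {S : E → F} {K : ℝ≥0} (hS : LipschitzWith K S) {x y h : E}
    {e : F} {c t δ : ℝ} (hc : ∀ z ∈ ball x δ, DifferentiableAt ℝ S z →
      ⟪e, fderiv ℝ S z h⟫ ≤ c) (ht : 0 ≤ t) (hy : dist y x + t * ‖h‖ < δ) :
    ⟪e, S (y + t • h) - S y⟫ ≤ c * t := by
  let μ : Measure E := Measure.addHaar
  -- By Rademacher, base points with almost everywhere differentiability along `h` are dense; the
  -- inequality extends to `y` by continuity.
  have hd := Measure.dense_of_ae (ae_ae_add_smul μ (hS.ae_differentiableAt (μ := μ)) h)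
  have hyc := hd y
  rw [mem_closure_iff_seq_limit] at hyc
  obtain ⟨ys, hys, hlim⟩ := hyc
  have hev : ∀ᶠ k in atTop, dist (ys k) x + t * ‖h‖ < δ :=
    ((hlim.dist tendsto_const_nhds).add_const _).eventually_lt_const hy
  have hcont : Continuous fun y => ⟪e, S (y + t • h) - S y⟫ := by
    have := hS.continuous
    fun_prop
  refine le_of_tendsto ((hcont.tendsto y).comp hlim) ?_
  filter_upwards [hev] with k hk
  refine inner_add_smul_sub_le_of_ae hS ht (hys k) fun s hs hdiff => hc _ ?_ hdiff
  rw [mem_ball]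
  calc dist (ys k + s • h) x ≤ dist (ys k + s • h) (ys k) + dist (ys k) x := dist_triangle _ _ _
    _ = s * ‖h‖ + dist (ys k) x := by
      rw [dist_eq_norm, add_sub_cancel_left, norm_smul, Real.norm_of_nonneg hs.1]
    _ ≤ t * ‖h‖ + dist (ys k) x := by gcongr; exact hs.2
    _ < δ := by linarith

/-- The limiting normals to the graph of a Lipschitz mapping are controlled by the Clarke
generalized Jacobian. -/
theorem exists_mem_clarkeJacobian_inner_eq {S : E → F} {K : ℝ≥0} (hS : LipschitzWith K S)
    {x w : E} {e : F} {xs ws : ℕ → E} {es : ℕ → F} (hxs : Tendsto xs atTop (𝓝 x))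
    (hws : Tendsto ws atTop (𝓝 w)) (hes : Tendsto es atTop (𝓝 e))
    (hreg : ∀ k, ∀ ε > 0, ∀ᶠ z in 𝓝 (xs k),
      ⟪ws k, z - xs k⟫ - ⟪es k, S z - S (xs k)⟫ ≤ ε * ‖z - xs k‖) :
    ∃ U ∈ clarkeJacobian S x, ∀ h, ⟪w, h⟫ = ⟪e, U h⟫ := by
  let A : (E →L[ℝ] F) →L[ℝ] (E →L[ℝ] ℝ) := ContinuousLinearMap.compL ℝ E F ℝ (innerSL ℝ e)
  by_contra! hcon
  have hnot : innerSL ℝ w ∉ A '' clarkeJacobian S x := by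
    rintro ⟨U, hU, hUw⟩
    obtain ⟨h, hh⟩ := hcon U hU
    apply hh
    have := congrArg (fun f : E →L[ℝ] ℝ => f h) hUw
    simpa [A] using this.symm
  have hconv : Convex ℝ (A '' clarkeJacobian S x) :=
    (convex_convexHull ℝ _).linear_image A.toLinearMap
  have hclosed : IsClosed (A '' clarkeJacobian S x) :=
    ((isCompact_clarkeJacobian hS x).image A.continuous).isClosed
  obtain ⟨f, u, hfu, huw⟩ := geometric_hahn_banach_closed_point hconv hclosed hnot
  -- By Riesz, the separating functional on the dual is evaluation at a vector `h`, so `⟪e, U h⟫ < u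
  -- < ⟪w, h⟫` for every `U`.
  obtain ⟨h, hf⟩ : ∃ h : E, ∀ g : E →L[ℝ] ℝ, f g = g h := by
    let f' : E →L[ℝ] ℝ := f.comp (innerSL ℝ : E →L[ℝ] E →L[ℝ] ℝ)
    refine ⟨(InnerProductSpace.toDual ℝ E).symm f', fun g => ?_⟩
    obtain ⟨y, rfl⟩ := (InnerProductSpace.toDual ℝ E).surjective g
    have : f' y = ⟪(InnerProductSpace.toDual ℝ E).symm f', y⟫ := by simp
    rw [InnerProductSpace.toDual_apply_apply, real_inner_comm, ← this]
    rfl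
  rw [hf] at huw
  obtain ⟨δ, hδ, hball⟩ := exists_ball_inner_fderiv_le hS (x := x) (h := h) (e := e) (c := u)
    fun U hU => by
      have := hfu _ ⟨U, subset_convexHull ℝ _ hU, rfl⟩
      rw [hf] at this
      simpa [A] using this
  have huw' : u < ⟪w, h⟫ := by simpa using huw
  -- Testing the normal inequality along `xs k + t • h`. The extra term pays for replacing `es k` by
  -- `e`; in the limit `⟪w, h⟫ ≤ u`, a contradiction.
  have key : ∀ᶠ k in atTop, ⟪ws k, h⟫ ≤ u + ‖es k - e‖ * (K * ‖h‖) := by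
    filter_upwards [hxs.eventually (ball_mem_nhds x hδ)] with k hk
    have hk : dist (xs k) x < δ := hk
    refine le_of_forall_pos_le_add fun ε hε => ?_
    have hη : 0 < ε / (‖h‖ + 1) := by positivity
    have hline : Tendsto (fun t : ℝ => xs k + t • h) (𝓝[>] 0) (𝓝 (xs k)) := by
      have : Continuous fun t : ℝ => xs k + t • h := by fun_prop
      simpa using (this.tendsto 0).mono_left nhdsWithin_le_nhds
    have hsmall : ∀ᶠ t : ℝ in 𝓝[>] 0, dist (xs k) x + t * ‖h‖ < δ := by
      have : Continuous fun t : ℝ => dist (xs k) x + t * ‖h‖ := by fun_prop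
      exact ((this.tendsto 0).mono_left nhdsWithin_le_nhds).eventually_lt_const (by simpa using hk)
    obtain ⟨t, ⟨h1, h2⟩, ht⟩ := ((hline.eventually (hreg k _ hη)).and hsmall |>.and
      self_mem_nhdsWithin).exists
    have ht : 0 < t := ht
    have h3 := inner_add_smul_sub_le hS hball ht.le h2
    have h4 : ⟪es k - e, S (xs k + t • h) - S (xs k)⟫ ≤ ‖es k - e‖ * (K * (t * ‖h‖)) := by
      refine (real_inner_le_norm _ _).trans ?_
      gcongr
      refine (hS.norm_sub_le _ _).trans ?_
      rw [add_sub_cancel_left, norm_smul, Real.norm_of_nonneg ht.le]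
    rw [inner_sub_left] at h4
    rw [add_sub_cancel_left, inner_smul_right, norm_smul, Real.norm_of_nonneg ht.le] at h1
    have h5 : ε / (‖h‖ + 1) * (t * ‖h‖) ≤ t * ε := by
      have : ε / (‖h‖ + 1) * ‖h‖ ≤ ε := by
        rw [div_mul_eq_mul_div, div_le_iff₀ (by positivity)]
        nlinarith
      nlinarith
    have h6 : t * ⟪ws k, h⟫ ≤ t * (u + ‖es k - e‖ * (K * ‖h‖) + ε) := by nlinarith
    exact le_of_mul_le_mul_left h6 ht
  have hl : Tendsto (fun k => ⟪ws k, h⟫) atTop (𝓝 ⟪w, h⟫) := hws.inner tendsto_const_nhds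
  have hr : Tendsto (fun k => u + ‖es k - e‖ * (K * ‖h‖)) atTop (𝓝 u) := by
    have := (((hes.sub_const e).norm).mul_const (K * ‖h‖)).const_add u
    simpa using this
  exact absurd (le_of_tendsto_of_tendsto hl hr key) huw'.not_ge

end Clarke

/-! ### Transfer of normals from `Prox_{σ r*}` to `Prox_r`, and the conclusion. -/

section Main
open scoped RealInnerProductSpace

/-- The quadratic form equals `(‖h‖² - ⟪U h, h⟫) + σ ⟪U h, h⟫`, a sum of nonnegative terms that
vanishes only at `h = 0`. -/
theorem isUnit_one_add_sub_one_smul {E : Type*} [NormedAddCommGroup E] [InnerProductSpace ℝ E]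
    [FiniteDimensional ℝ E] {U : E →L[ℝ] E} (hU : ∀ h, 0 ≤ ⟪U h, h⟫ ∧ ⟪U h, h⟫ ≤ ‖h‖ ^ 2) {σ : ℝ}
    (hσ : 0 < σ) : IsUnit (1 + (σ - 1) • U) := by
  rw [ContinuousLinearMap.isUnit_iff_isUnit_toLinearMap, LinearMap.isUnit_iff_ker_eq_bot,
    LinearMap.ker_eq_bot']
  intro h hh
  have h1 : ⟪h + (σ - 1) • U h, h⟫ = 0 := by
    have : h + (σ - 1) • U h = 0 := hh
    rw [this, inner_zero_left]
  rw [inner_add_left, real_inner_smul_left, real_inner_self_eq_norm_sq] at h1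
  obtain ⟨h2, h3⟩ := hU h
  have h4 : ‖h‖ ^ 2 ≤ 0 := by
    by_contra! hpos
    rcases h2.eq_or_lt with h0 | h0
    · rw [← h0] at h1
      linarith
    · nlinarith
  simpa using h4

theorem limitingCoderivative_resolvent {E : Type*} [NormedAddCommGroup E] [InnerProductSpace ℝ E]
    [FiniteDimensional ℝ E] [MeasurableSpace E] [BorelSpace E] {f : E → EReal} {P : E → E}
    {Q : E → Set E} {σ : ℝ} (hσ : 0 < σ) (hP : ∀ z, IsSubgradient f (P z) (z - P z))
    (hPu : ∀ x u, IsSubgradient f x u → P (x + u) = x)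
    (hQ : ∀ y u, u ∈ Q y ↔ IsSubgradient f (σ⁻¹ • (y - u)) u) {x u v d : E}
    (hv : v ∈ limitingCoderivative Q (u + σ • x) u d) :
    ∃ U ∈ clarkeJacobian P (x + u), ∀ h, ⟪v - d, h⟫ = ⟪-d - (σ - 1) • v, U h⟫ := by
  have hlip := IsSubgradient.lipschitzWith_resolvent hP
  obtain ⟨-, ps, qs, hps, hpslim, hqs, hqslim⟩ := hv
  have hp1 : Tendsto (fun k => (ps k).fst) atTop (𝓝 (u + σ • x)) :=
    ((WithLp.prod_continuous_ofLp 2 E E).fst.tendsto _).comp hpslim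
  have hp2 : Tendsto (fun k => (ps k).snd) atTop (𝓝 u) :=
    ((WithLp.prod_continuous_ofLp 2 E E).snd.tendsto _).comp hpslim
  have hq1 : Tendsto (fun k => (qs k).fst) atTop (𝓝 v) :=
    ((WithLp.prod_continuous_ofLp 2 E E).fst.tendsto _).comp hqslim
  have hq2 : Tendsto (fun k => (qs k).snd) atTop (𝓝 (-d)) :=
    ((WithLp.prod_continuous_ofLp 2 E E).snd.tendsto _).comp hqslim
  have hsub : ∀ k, IsSubgradient f (σ⁻¹ • ((ps k).fst - (ps k).snd)) (ps k).snd :=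
    fun k => (hQ _ _).1 (hps k)
  let T := (WithLp.prodContinuousLinearEquiv 2 ℝ E E).symm.toContinuousLinearMap
  let A : E →L[ℝ] WithLp 2 (E × E) :=
    T.comp ((ContinuousLinearMap.id ℝ E).prod (ContinuousLinearMap.id ℝ E))
  let B : E →L[ℝ] WithLp 2 (E × E) :=
    T.comp (((σ - 1) • ContinuousLinearMap.id ℝ E).prod (-ContinuousLinearMap.id ℝ E))
  -- With `x = P z` and `u = z - P z`, this is `(u + σ x, u)`.
  let Φ : E → WithLp 2 (E × E) := fun z => A z + B (P z)
  have hΦ : Continuous Φ := A.continuous.add (B.continuous.comp hlip.continuous)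
  have hΦ1 : ∀ z, (Φ z).fst = z + (σ - 1) • P z := fun z => rfl
  have hΦ2 : ∀ z, (Φ z).snd = z + -P z := fun z => rfl
  have hΦQ : ∀ z, Φ z ∈ gph Q := by
    intro z
    have h1 : σ⁻¹ • ((z + (σ - 1) • P z) - (z + -P z)) = P z := by
      rw [show (z + (σ - 1) • P z) - (z + -P z) = σ • P z by module, inv_smul_smul₀ hσ.ne']
    change (Φ z).snd ∈ Q (Φ z).fst
    rw [hQ, hΦ1, hΦ2, h1, ← sub_eq_add_neg]
    exact hP z
  -- The parameter `x + u` recovered from the graph point `(u + σ x, u)`.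
  set zs : ℕ → E := fun k => σ⁻¹ • ((ps k).fst - (ps k).snd) + (ps k).snd with hzs
  have hPz : ∀ k, P (zs k) = σ⁻¹ • ((ps k).fst - (ps k).snd) := fun k => hPu _ _ (hsub k)
  have hΦz : ∀ k, Φ (zs k) = ps k := by
    intro k
    have h1 : σ • P (zs k) = (ps k).fst - (ps k).snd := by rw [hPz, smul_inv_smul₀ hσ.ne']
    have h2 : zs k = P (zs k) + (ps k).snd := by rw [hPz]
    apply (WithLp.equiv 2 (E × E)).injective
    apply Prod.ext
    · change (Φ (zs k)).fst = (ps k).fst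
      rw [hΦ1]
      nth_rewrite 1 [h2]
      rw [sub_smul, h1]
      module
    · change (Φ (zs k)).snd = (ps k).snd
      rw [hΦ2]
      nth_rewrite 1 [h2]
      abel
  refine exists_mem_clarkeJacobian_inner_eq hlip (xs := zs)
    (ws := fun k => (qs k).fst + (qs k).snd)
    (es := fun k => (qs k).snd - (σ - 1) • (qs k).fst) ?_ ?_ ?_ fun k ε hε => ?_
  · have := ((hp1.sub hp2).const_smul σ⁻¹).add hp2
    simpa [inv_smul_smul₀ hσ.ne'] using this
  · simpa [sub_eq_add_neg] using hq1.add hq2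
  · exact hq2.sub (hq1.const_smul _)
  -- A Lipschitz constant for `Φ`, made positive so that `ε / C` can be used.
  · set C := ‖A‖ + ‖B‖ + 1 with hC
    have hC0 : 0 < C := by positivity
    have hreg := (hqs k).2 (ε / C) (by positivity)
    have htend : Tendsto Φ (𝓝 (zs k)) (𝓝[gph Q] (ps k)) :=
      tendsto_nhdsWithin_iff.2 ⟨hΦz k ▸ hΦ.tendsto _, Eventually.of_forall hΦQ⟩
    filter_upwards [htend.eventually hreg] with z hz
    rw [← hΦz k, WithLp.prod_inner_apply] at hz
    have hnorm : ‖Φ z - Φ (zs k)‖ ≤ C * ‖z - zs k‖ := by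
      have h1 : Φ z - Φ (zs k) = A (z - zs k) + B (P z - P (zs k)) := by
        simp only [Φ, map_sub]
        abel
      have h2 : ‖P z - P (zs k)‖ ≤ ‖z - zs k‖ := by simpa using hlip.norm_sub_le z (zs k)
      rw [h1]
      calc _ ≤ ‖A‖ * ‖z - zs k‖ + ‖B‖ * ‖P z - P (zs k)‖ :=
            norm_add_le_of_le (A.le_opNorm _) (B.le_opNorm _)
        _ ≤ ‖A‖ * ‖z - zs k‖ + ‖B‖ * ‖z - zs k‖ := by gcongr
        _ ≤ C * ‖z - zs k‖ := by rw [hC]; linarith [norm_nonneg (z - zs k)]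
    have h3 : ε / C * ‖Φ z - Φ (zs k)‖ ≤ ε * ‖z - zs k‖ := by
      calc _ ≤ ε / C * (C * ‖z - zs k‖) := by gcongr
        _ = _ := by field_simp
    have h4 : ⟪(qs k).fst, (Φ z).fst - (Φ (zs k)).fst⟫ + ⟪(qs k).snd, (Φ z).snd - (Φ (zs k)).snd⟫
        ≤ ε * ‖z - zs k‖ := hz.trans h3
    refine le_trans (le_of_eq ?_) h4
    rw [hΦ1, hΦ1, hΦ2, hΦ2]
    simp only [inner_add_left, inner_sub_left, inner_sub_right, inner_add_right,
      inner_neg_right, real_inner_smul_left, inner_smul_right]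
    ring

end Main
end ProxCoderivative
end

theorem mainTheorem3 (m : ℕ) (r : EuclideanSpace ℝ (Fin m) → EReal)
    (hbot : ∀ x, r x ≠ ⊥)
    (hlsc : LowerSemicontinuous r)
    (hconv : Convex ℝ (ProxCoderivative.epigraph r))
    (xbar ubar : EuclideanSpace ℝ (Fin m))
    (hx : xbar ∈ ProxCoderivative.effDom r)
    (hu : ubar ∈ ProxCoderivative.limitingSubdifferential r xbar)
    (σ : ℝ) (hσ : 0 < σ) :
    (∀ x, ∃! p, p ∈ ProxCoderivative.proxSet 1 r x) ∧
    (∀ x, ∃! p, p ∈ ProxCoderivative.proxSet σ (ProxCoderivative.conjugate r) x) ∧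
    ∀ d : EuclideanSpace ℝ (Fin m),
      ∀ v ∈ ProxCoderivative.limitingCoderivative
        (ProxCoderivative.proxSet σ (ProxCoderivative.conjugate r)) (ubar + σ • xbar)
        (ProxCoderivative.prox σ (ProxCoderivative.conjugate r) (ubar + σ • xbar)) d,
      ∃ U ∈ ProxCoderivative.clarkeJacobian (ProxCoderivative.prox 1 r) (xbar + ubar),
        IsUnit (1 + (σ - 1) • U) ∧
        v = Ring.inverse (1 + (σ - 1) • U) ((1 - U) d) := by
  have h₀ := ProxCoderivative.IsSubgradient.of_mem_limitingSubdifferential hbot hconv hu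
  have hbot' := ProxCoderivative.conjugate_ne_bot h₀
  have hconv' := ProxCoderivative.convex_epigraph_conjugate hbot
  have hne := ProxCoderivative.proxSet_nonempty hbot hlsc h₀ one_pos
  have hne' := ProxCoderivative.proxSet_conjugate_nonempty hbot hlsc hconv h₀ hσ
  refine ⟨fun x => existsUnique_of_exists_of_unique (hne x) fun p q hp hq =>
      ProxCoderivative.eq_of_mem_proxSet hbot hconv one_pos hp hq,
    fun x => existsUnique_of_exists_of_unique (hne' x) fun p q hp hq =>
      ProxCoderivative.eq_of_mem_proxSet hbot' hconv' hσ hp hq, fun d v hv => ?_⟩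
  have hprox : ∀ z, ProxCoderivative.prox 1 r z ∈ ProxCoderivative.proxSet 1 r z :=
    fun z => Classical.epsilon_spec (hne z)
  have hP : ∀ z, ProxCoderivative.IsSubgradient r (ProxCoderivative.prox 1 r z)
      (z - ProxCoderivative.prox 1 r z) := fun z => by
    simpa using ProxCoderivative.IsSubgradient.of_mem_proxSet hbot hconv one_pos (hprox z)
  have hPu : ∀ x u, ProxCoderivative.IsSubgradient r x u →
      ProxCoderivative.prox 1 r (x + u) = x := fun x u h =>
    ProxCoderivative.eq_of_mem_proxSet hbot hconv one_pos (hprox _)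
      (by simpa using ProxCoderivative.mem_proxSet_of_isSubgradient hbot one_pos h)
  have hubar : ProxCoderivative.prox σ (ProxCoderivative.conjugate r) (ubar + σ • xbar) = ubar :=
    ProxCoderivative.eq_of_mem_proxSet hbot' hconv' hσ (Classical.epsilon_spec (hne' _))
      (ProxCoderivative.mem_proxSet_of_isSubgradient hbot' hσ (h₀.conjugate hbot))
  rw [hubar] at hv
  obtain ⟨U, hU, hUv⟩ := ProxCoderivative.limitingCoderivative_resolvent hσ hP hPu
    (fun y u => ProxCoderivative.mem_proxSet_conjugate_iff hbot hlsc hconv h₀ hσ) hv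
  obtain ⟨hsymm, hpos⟩ := ProxCoderivative.IsSubgradient.clarkeJacobian_resolvent hP hU
  have hunit := ProxCoderivative.isUnit_one_add_sub_one_smul hpos hσ
  refine ⟨U, hU, hunit, ?_⟩
  -- Symmetry replaces the adjoint of `U` by `U` itself.
  have hw : v - d = U (-d - (σ - 1) • v) := ext_inner_right ℝ fun h => by rw [hUv, hsymm]
  have heq : (1 + (σ - 1) • U) v = (1 - U) d := by
    rw [map_sub, map_neg, map_smul] at hw
    change v + (σ - 1) • U v = d - U d
    calc v + (σ - 1) • U v = (v - d) + d + (σ - 1) • U v := by abel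
      _ = d - U d := by rw [hw]; abel
  rw [← heq, ← mul_apply_eq_comp, Ring.inverse_mul_cancel _ hunit]
  rfl
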